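/- Let $T$ be a finite tree. Consider the following game on a finite connected graph $G$ with an integer radius of capture $\rho\ge 0$. The cop first fixes a \emph{patrol}, an infinite sequence $c_0,c_1,c_2,\dots$ of vertices such that for every $t$ either $c_{t+1}=c_t$ or $c_{t+1}$ is adjacent to $c_t$. The robber knows the whole patrol and then chooses a sequence $r_0,r_1,r_2,\dots$ of vertices subject to the same condition. The cop starts at $c_0$, then the robber starts at $r_0$, and they move alternately, the cop first: in round $t\ge 0$ the cop moves from $c_t$ to $c_{t+1}$ and then the robber moves from $r_t$ to $r_{t+1}$. The robber is captured if, for some $t\ge 0$, $d(c_t,r_t)\le\rho$ or $d(c_{t+1},r_t)\le\rho$. The cop wins on $G$ with radius $\rho$ if he has a patrol that captures every robber. Let $\rho(G)$ be the minimum $\rho\ge 0$ for which the cop wins on $G$. A \emph{triod} is a tree with exactly three leaves and a unique vertex of degree three, called its \emph{origin}; its \emph{size} is the distance from the origin to the closest of the three leaves. For a vertex $v$ of a graph, let $\ell_3(v)$ be the largest size of an induced triod with origin $v$, and $\ell_3(v)=0$ if there is no such triod (in particular, if $\deg v<3$). Then \[ \rho(T)=\max_{v\in V(T)}\left\lfloor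 \frac{\ell_3(v)}{2}\right\rfloor . \] -/

import Mathlib

namespace PatrolGame

variable {V : Type*}

/-- A trajectory of a player on `G`: an infinite sequence of positions in which the player, at each
of his moves, either stays where he is or goes to an adjacent vertex. The cop's patrol is such a
trajectory; the robber, who knows the whole patrol in advance, answers with such a trajectory. -/
def IsTrajectory (G : SimpleGraph V) (p : ℕ → V) : Prop :=
  ∀ t, p (t + 1) = p t ∨ G.Adj (p t) (p (t + 1))

/-- The play of the patrol `c` against the robber trajectory `r`. The cop starts at `c 0`, the
robber then starts at `r 0`; afterwards they alternate, the cop moving from `c t` to `c (t + 1)`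
and the robber answering by moving from `r t` to `r (t + 1)`. The robber is captured, with radius
of capture `ρ`, if the distance between the players is at most `ρ` after some move of the robber
(this includes the choice of his starting position) or after some move of the cop. -/
def IsCaptured (G : SimpleGraph V) (ρ : ℕ) (c r : ℕ → V) : Prop :=
  ∃ t, G.dist (c t) (r t) ≤ ρ ∨ G.dist (c (t + 1)) (r t) ≤ ρ

/-- The cop with radius of capture `ρ` wins on the connected graph `G`: he has a patrol that
captures every robber. -/
def CopWins (G : SimpleGraph V) (ρ : ℕ) : Prop :=
  ∃ c, IsTrajectory G c ∧ ∀ r, IsTrajectory G r → IsCaptured G ρ c r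

/-- The minimum radius of capture with which the cop wins on the (finite, connected) graph `G`. -/
noncomputable def captureRadius (G : SimpleGraph V) : ℕ :=
  sInf {ρ | CopWins G ρ}

/-- On a finite connected graph the minimum in the definition of `captureRadius` is attained. -/
theorem isLeast_captureRadius [Fintype V] (G : SimpleGraph V) (hG : G.Connected) :
    IsLeast {ρ | CopWins G ρ} (captureRadius G) := by
  have hne : {ρ | CopWins G ρ}.Nonempty := by
    obtain ⟨v⟩ := hG.nonempty
    refine ⟨Finset.univ.sup (G.dist v), fun _ => v, fun _ => Or.inl rfl, fun r _ => ?_⟩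
    exact ⟨0, Or.inl (Finset.le_sup (f := G.dist v) (Finset.mem_univ _))⟩
  exact ⟨Nat.sInf_mem hne, fun _ h => Nat.sInf_le h⟩

/-- The leaves of a graph: its vertices of degree one. -/
def leaves (G : SimpleGraph V) : Set V :=
  {v | (G.neighborSet v).ncard = 1}

/-- `G` is a triod with origin `o`: a tree with exactly three leaves, in which `o` is the unique
vertex of degree three. -/
def IsTriod (G : SimpleGraph V) (o : V) : Prop :=
  G.IsTree ∧ (leaves G).ncard = 3 ∧ ∀ v, (G.neighborSet v).ncard = 3 ↔ v = o

/-- The size of a triod `G` with origin `o`: the distance from `o` to the closest leaf. -/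
noncomputable def triodSize (G : SimpleGraph V) (o : V) : ℕ :=
  sInf (G.dist o '' leaves G)

/-- The sizes of the induced triods of `G` with origin `v`. -/
def inducedTriodSizes (G : SimpleGraph V) (v : V) : Set ℕ :=
  {k | ∃ (s : Set V) (hv : v ∈ s),
    IsTriod (G.induce s) ⟨v, hv⟩ ∧ k = triodSize (G.induce s) ⟨v, hv⟩}

/-- `ell3 G v` is the largest size of an induced triod of the finite graph `G` with origin `v`,
and `0` if there is no such triod (in particular, if `v` has degree less than three). -/
noncomputable def ell3 (G : SimpleGraph V) (v : V) : ℕ :=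
  sSup (inducedTriodSizes G v)

theorem bddAbove_inducedTriodSizes [Finite V] (G : SimpleGraph V) (v : V) :
    BddAbove (inducedTriodSizes G v) := by
  refine Set.Finite.bddAbove ((Set.finite_range
    fun p : {s : Set V // v ∈ s} => triodSize (G.induce p.1) ⟨v, p.2⟩).subset ?_)
  rintro k ⟨s, hv, -, rfl⟩
  exact ⟨⟨s, hv⟩, rfl⟩

theorem ell3_eq_zero [Finite V] (G : SimpleGraph V) (v : V)
    (h : (G.neighborSet v).ncard < 3) : ell3 G v = 0 := by
  have : inducedTriodSizes G v = ∅ := by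
    refine Set.eq_empty_of_forall_notMem ?_
    rintro k ⟨s, hv, ⟨-, -, h3⟩, -⟩
    have h4 := (h3 ⟨v, hv⟩).2 rfl
    have h5 : ((G.induce s).neighborSet ⟨v, hv⟩).ncard ≤ (G.neighborSet v).ncard :=
      Set.ncard_le_ncard_of_injOn Subtype.val (fun a ha => by simpa using ha)
        (Subtype.val_injective.injOn) (Set.toFinite _)
    omega
  simp [ell3, this]

end PatrolGame

/-!
The tree `T` has an induced triod of size at least `L ≥ 1` with origin `v` if and only if three
branches at `v` have depth at least `L` (`hasLongBranches_iff_le_ell3`). So the theorem says that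
the cop wins with radius `ρ` exactly if no vertex has three branches of depth `2 * ρ + 2` or more.

*Evasion* (`not_copWins_of_hasLongBranches`). Suppose three branches at `v` are that deep. Within
one of them the robber moves along a geodesic from `v`, keeping `ρ + 1` beyond the depth that the
cop has reached in this branch (counted negatively if the cop is elsewhere), or waiting at `v` if
that is enough. The leg is long enough for this while the cop is at depth at most `ρ + 1` in that
branch. When the cop is at depth `ρ + 2` or more in another branch, the robber can be at `v` and
may change branches. Since he knows the patrol, he can always use a branch that is different from
the one the cop has visited deeply last and from the one the cop will visit deeply next.

*Capture* (`copWins_of_forall_not_hasLongBranches`). Suppose no vertex has three branches that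
deep. Let `o` be an end of a longest path and root the tree at `o`. Below any vertex `x`, at most
one branch has depth `2 * ρ + 2` or more: if there were two, then `o` itself would be that far from
`x`, because the path is longest, and `x` would have three such branches. The cop walks down from
`o`; at each `x` he clears the shallow branches one after the other and then enters the deep one.
A branch of depth at most `2 * ρ + 1` at `x` is cleared by depth-first search down to depth `ρ + 1`
(`sweep_branch`): from depth `ρ + 1` the cop sees everything below him, and since he returns
at once, a robber who uses his absence to slip through `x` is captured on the cop's way back.
-/

namespace PatrolGame

/-! ### Branches of a tree -/

/-- The branch of `G` at `u` behind its neighbour `w`: the vertices that are closer to `w`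
than to `u`. -/
def branch {V : Type*} (G : SimpleGraph V) (u w : V) : Set V :=
  {y | G.dist u y = G.dist w y + 1}

section Branch

variable {V : Type*} {T : SimpleGraph V} {u w a b x y z : V}

theorem mem_branch : y ∈ branch T u w ↔ T.dist u y = T.dist w y + 1 := Iff.rfl

/-- In a tree, the neighbour of `y` on the way to `o` is unique. -/
theorem parent_unique (hT : T.IsTree) {o : V} (ha : T.Adj a y) (hb : T.Adj b y)
    (hda : T.dist o y = T.dist o a + 1) (hdb : T.dist o y = T.dist o b + 1) : a = b := by
  obtain ⟨p, hp⟩ := hT.connected.exists_walk_length_eq_dist o a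
  obtain ⟨q, hq⟩ := hT.connected.exists_walk_length_eq_dist o b
  have hp' : (p.concat ha).IsPath := SimpleGraph.Walk.isPath_of_length_eq_dist _ (by simp [hp, hda])
  have hq' : (q.concat hb).IsPath := SimpleGraph.Walk.isPath_of_length_eq_dist _ (by simp [hq, hdb])
  have h := congrArg Subtype.val ((hT.isAcyclic.subsingleton_path _ _).elim ⟨_, hp'⟩ ⟨_, hq'⟩)
  simpa using congrArg SimpleGraph.Walk.penultimate h

theorem exists_parent (hT : T.IsTree) {o : V} (h : y ≠ o) :
    ∃ a, T.Adj a y ∧ T.dist o y = T.dist o a + 1 := by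
  obtain ⟨p, hp⟩ := hT.connected.exists_walk_length_eq_dist y o
  cases p with
  | nil => exact absurd rfl h
  | cons hadj q =>
    refine ⟨_, hadj.symm, ?_⟩
    have h1 := SimpleGraph.dist_le q
    have h2 := hT.dist_eq_dist_add_one_of_adj o hadj
    rw [SimpleGraph.Walk.length_cons, SimpleGraph.dist_comm] at hp
    rw [SimpleGraph.dist_comm] at h1
    omega

theorem mem_branch_or (hT : T.IsTree) (h : T.Adj u w) (y : V) :
    y ∈ branch T u w ∨ y ∈ branch T w u := by
  have := hT.dist_eq_dist_add_one_of_adj y h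
  rwa [SimpleGraph.dist_comm, SimpleGraph.dist_comm (u := y)] at this

theorem notMem_branch (hT : T.IsTree) (h : T.Adj u w) :
    y ∉ branch T u w ↔ T.dist w y = T.dist u y + 1 := by
  have := mem_branch_or hT h y
  simp only [mem_branch] at *
  omega

theorem right_mem_branch (h : T.Adj u w) : w ∈ branch T u w := by
  simp [mem_branch, SimpleGraph.dist_eq_one_iff_adj.2 h]

theorem left_notMem_branch : u ∉ branch T u w := by
  simp [mem_branch]

/-- The only edge that leaves a branch is the one that defines it. -/
theorem eq_of_adj_of_mem_branch (hT : T.IsTree) (h : T.Adj u w) (hab : T.Adj a b)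
    (ha : a ∈ branch T u w) (hb : b ∉ branch T u w) : a = w ∧ b = u := by
  rw [notMem_branch hT h] at hb
  rw [mem_branch] at ha
  have h1 := hT.dist_eq_dist_add_one_of_adj w hab
  have h2 := hT.dist_eq_dist_add_one_of_adj u hab
  have haw : a = w := by
    by_contra hne
    obtain ⟨c, hc, hcd⟩ := exists_parent hT hne
    have h3 := hT.dist_eq_dist_add_one_of_adj u hc
    have h4 := hT.connected.dist_triangle (u := u) (v := w) (w := c)
    rw [SimpleGraph.dist_eq_one_iff_adj.2 h] at h4
    have := parent_unique hT (o := u) hc hab.symm (by omega) (by omega)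
    subst this
    omega
  subst haw
  rw [SimpleGraph.dist_self] at *
  exact ⟨rfl, ((hT.connected.dist_eq_zero_iff).1 (by omega : T.dist u b = 0)).symm⟩

/-- A geodesic from inside a branch to the outside passes through the edge that defines it. -/
theorem dist_of_mem_branch (hT : T.IsTree) (h : T.Adj u w) (hy : y ∈ branch T u w)
    (hz : z ∉ branch T u w) : T.dist y z = T.dist u y + T.dist u z := by
  have key : ∀ {y z : V} (p : T.Walk y z), y ∈ branch T u w → z ∉ branch T u w →
      T.dist w y + 1 + T.dist u z ≤ p.length := by
    intro y z p
    induction p with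
    | nil => exact fun h1 h2 => absurd h1 h2
    | @cons a b c hab q ih =>
      intro ha hc
      rw [SimpleGraph.Walk.length_cons]
      by_cases hb : b ∈ branch T u w
      · have := ih hb hc
        have := hT.dist_eq_dist_add_one_of_adj w hab
        omega
      · obtain ⟨rfl, rfl⟩ := eq_of_adj_of_mem_branch hT h hab ha hb
        have := SimpleGraph.dist_le q
        rw [SimpleGraph.dist_self]
        omega
  obtain ⟨p, hp⟩ := hT.connected.exists_walk_length_eq_dist y z
  have h1 := key p hy hz
  have h2 := hT.connected.dist_triangle (u := y) (v := u) (w := z)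
  rw [SimpleGraph.dist_comm (u := y) (v := u)] at h2
  rw [mem_branch] at hy
  omega

theorem exists_mem_branch (hT : T.IsTree) (h : y ≠ x) :
    ∃ w, T.Adj x w ∧ y ∈ branch T x w := by
  obtain ⟨w, hw, hd⟩ := exists_parent hT h.symm
  refine ⟨w, hw.symm, ?_⟩
  rw [mem_branch, SimpleGraph.dist_comm, hd, SimpleGraph.dist_comm]

/-- The branches at a vertex of a tree are disjoint. -/
theorem branch_unique (hT : T.IsTree) (ha : T.Adj x a) (hb : T.Adj x b)
    (hya : y ∈ branch T x a) (hyb : y ∈ branch T x b) : a = b := by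
  rw [mem_branch, SimpleGraph.dist_comm, SimpleGraph.dist_comm (u := a)] at hya
  rw [mem_branch, SimpleGraph.dist_comm, SimpleGraph.dist_comm (u := b)] at hyb
  exact parent_unique hT ha.symm hb.symm hya hyb

theorem branch_subset (hT : T.IsTree) (hxw : T.Adj x w) (hwa : T.Adj w a) (hax : a ≠ x) :
    branch T w a ⊆ branch T x w := by
  intro y hy
  by_contra hy'
  rw [notMem_branch hT hxw] at hy'
  exact hax (branch_unique hT hwa hxw.symm hy hy')

theorem dist_eq_add_of_mem_branch (hT : T.IsTree) (hxw : T.Adj x w) {o : V}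
    (hy : y ∈ branch T x w) (ho : o ∉ branch T x w) : T.dist o y = T.dist o x + T.dist x y := by
  rw [SimpleGraph.dist_comm, dist_of_mem_branch hT hxw hy ho, SimpleGraph.dist_comm (u := o),
    add_comm]

/-- Three branches of `T` at `v` have depth at least `L`: `a i` is a vertex at distance at least `L`
from `v` in the branch behind the neighbour `w i` of `v`. -/
def HasLongBranches {V : Type*} (T : SimpleGraph V) (v : V) (L : ℕ) : Prop :=
  ∃ w a : Fin 3 → V, Function.Injective w ∧
    ∀ i, T.Adj v (w i) ∧ a i ∈ branch T v (w i) ∧ L ≤ T.dist v (a i)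

end Branch

/-! ### Sweeping a tree -/

section Sweep

variable {V : Type*} {T : SimpleGraph V} {ρ d : ℕ} {S : Set V} {x w : V}

/-- One round of a search: the state `(c, S)` says that the cop is at `c` and the robber is known
not to be in `S`. If the cop moves to `c'` and the robber answers without being captured, then
he is still not in `S'`. -/
def SweepStep (G : SimpleGraph V) (ρ : ℕ) (p q : V × Set V) : Prop :=
  (q.1 = p.1 ∨ G.Adj p.1 q.1) ∧
    ∀ r ∉ p.2, ∀ r', (r' = r ∨ G.Adj r r') → ρ < G.dist p.1 r → ρ < G.dist q.1 r →
      ρ < G.dist q.1 r' → r' ∉ q.2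

/-- The cop can pass from the state `p` to the state `q` in finitely many rounds. -/
abbrev Sweep (G : SimpleGraph V) (ρ : ℕ) : V × Set V → V × Set V → Prop :=
  Relation.ReflTransGen (SweepStep G ρ)

theorem copWins_of_sweep {c : V} (h : Sweep T ρ (x, ∅) (c, Set.univ)) : CopWins T ρ := by
  suffices H : ∀ p, Sweep T ρ p (c, Set.univ) → ∃ f, f 0 = p.1 ∧ IsTrajectory T f ∧
      ∀ r, IsTrajectory T r → r 0 ∉ p.2 → IsCaptured T ρ f r by
    obtain ⟨f, -, hf, hc⟩ := H _ h
    exact ⟨f, hf, fun r hr => hc r hr (Set.notMem_empty _)⟩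
  intro p hp
  induction hp using Relation.ReflTransGen.head_induction_on with
  | refl => exact ⟨fun _ => c, rfl, fun _ => Or.inl rfl, fun r _ h => absurd (Set.mem_univ _) h⟩
  | @head p q hpq _ ih =>
    obtain ⟨f, hf0, hf, hc⟩ := ih
    refine ⟨fun n => Nat.casesOn n p.1 f, rfl, ?_, ?_⟩
    · rintro (_ | t)
      · change f 0 = p.1 ∨ T.Adj p.1 (f 0)
        rw [hf0]
        exact hpq.1
      · exact hf t
    · intro r hr h0
      by_cases h1 : T.dist p.1 (r 0) ≤ ρ
      · exact ⟨0, Or.inl h1⟩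
      by_cases h2 : T.dist q.1 (r 0) ≤ ρ
      · exact ⟨0, Or.inr (by simpa [hf0] using h2)⟩
      by_cases h3 : T.dist q.1 (r 1) ≤ ρ
      · exact ⟨1, Or.inl (by simpa [hf0] using h3)⟩
      push Not at h1 h2 h3
      obtain ⟨t, ht⟩ := hc (fun n => r (n + 1)) (fun n => hr (n + 1))
        (hpq.2 _ h0 _ (hr 0) h1 h2 h3)
      exact ⟨t + 1, ht⟩

/-- Every vertex of `S` that has a neighbour outside `S` is within distance `d` of `x`. -/
def Guards (G : SimpleGraph V) (x : V) (d : ℕ) (S : Set V) : Prop :=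
  ∀ a ∈ S, ∀ b ∉ S, G.Adj a b → G.dist x a ≤ d

theorem Guards.mono {e : ℕ} (h : Guards T x d S) (hde : d ≤ e) : Guards T x e S :=
  fun a ha b hb hab => (h a ha b hb hab).trans hde

/-- If the cop, at his new position, guards the cleared set, then no robber enters it. -/
theorem Guards.sweepStep (hxw : w = x ∨ T.Adj x w) (h : Guards T w ρ S) :
    SweepStep T ρ (x, S) (w, S ∪ {w}) := by
  refine ⟨hxw, ?_⟩
  rintro r hr r' hrr' - - h3 (hr' | rfl)
  · rcases hrr' with rfl | hadj
    · exact hr hr'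
    · exact absurd (h r' hr' r hr hadj.symm) (not_le.2 h3)
  · simp at h3

theorem Guards.union_branch (hT : T.IsTree) (h : Guards T x d S) (hx : x ∈ S)
    (hxw : T.Adj x w) : Guards T x d (S ∪ branch T x w) := by
  rintro a (ha | ha) b hb hab
  · exact h a ha b (fun hb' => hb (Or.inl hb')) hab
  · have := (eq_of_adj_of_mem_branch hT hxw hab ha (fun hb' => hb (Or.inr hb'))).2
    exact absurd (Or.inl (this ▸ hx)) hb

theorem Guards.union_singleton (hT : T.IsTree) (h : Guards T x d S) (hxw : T.Adj x w) :
    Guards T w (d + 1) (S ∪ {w}) := by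
  rintro a (ha | rfl) b hb hab
  · have h1 := h a ha b (fun hb' => hb (Or.inl hb')) hab
    have h2 := hT.connected.dist_triangle (u := w) (v := x) (w := a)
    rw [SimpleGraph.dist_eq_one_iff_adj.2 hxw.symm] at h2
    omega
  · simp

/-- The cop can clear one after the other the branches behind the vertices of `F`. -/
theorem sweep_biUnion [DecidableEq V] (hT : T.IsTree) (F : Finset V) (hF : ∀ w ∈ F, T.Adj x w)
    (hclear : ∀ w ∈ F, ∀ S, x ∈ S → Guards T x d S →
      Sweep T ρ (x, S) (x, S ∪ branch T x w)) :
    ∀ S, x ∈ S → Guards T x d S →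
      Sweep T ρ (x, S) (x, S ∪ ⋃ w ∈ F, branch T x w) ∧
        Guards T x d (S ∪ ⋃ w ∈ F, branch T x w) := by
  induction F using Finset.induction_on with
  | empty =>
    intro S _ hS
    simp only [Finset.notMem_empty, Set.iUnion_of_empty, Set.iUnion_empty, Set.union_empty]
    exact ⟨Relation.ReflTransGen.refl, hS⟩
  | insert w F _ ih =>
    intro S hx hS
    rw [Finset.set_biUnion_insert, ← Set.union_assoc]
    have hw := hF w (Finset.mem_insert_self _ _)
    have h2 := ih (fun w hw => hF w (Finset.mem_insert_of_mem hw))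
      (fun w hw => hclear w (Finset.mem_insert_of_mem hw)) (S ∪ branch T x w) (Or.inl hx)
      (hS.union_branch hT hx hw)
    exact ⟨(hclear w (Finset.mem_insert_self _ _) S hx hS).trans h2.1, h2.2⟩

/-- Excursions at distance `ρ` from the farthest guarded vertex: the cop goes to `w` and comes
straight back. -/
theorem sweep_branch_of_depth_le (hT : T.IsTree) (hxw : T.Adj x w)
    (hdepth : ∀ y ∈ branch T x w, T.dist x y ≤ ρ + 1) (hS : Guards T x ρ S) :
    Sweep T ρ (x, S) (x, S ∪ branch T x w) := by
  -- While the cop is at `w`, only the part of `S` out of reach of `x` counts as clear: a robber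
  -- who enters the rest of `S` is captured when the cop is back at `x`.
  refine Relation.ReflTransGen.head
    (b := (w, (S \ {y | T.dist x y ≤ ρ}) ∪ branch T x w)) ⟨Or.inr hxw, ?_⟩
    (Relation.ReflTransGen.single ⟨Or.inr hxw.symm, ?_⟩)
  · rintro r hr r' hrr' - - h3 (⟨hr', hd⟩ | hr')
    · rcases hrr' with rfl | hadj
      · exact hr hr'
      · exact hd (hS r' hr' r hr hadj.symm)
    · have h4 := hdepth r' hr'
      rw [mem_branch] at hr'
      dsimp only at h3
      omega
  · rintro r hr r' hrr' - h2 h3 hr'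
    dsimp only at hr h2 h3 hr'
    have hrS : r ∉ S := fun h => hr (Or.inl ⟨h, not_le.2 h2⟩)
    have hrB : r ∉ branch T x w := fun h => hr (Or.inr h)
    rcases hrr' with rfl | hadj
    · exact hr'.elim hrS hrB
    · rcases hr' with hr' | hr'
      · exact absurd (hS r' hr' r hrS hadj.symm) (not_le.2 h3)
      · obtain ⟨-, rfl⟩ := eq_of_adj_of_mem_branch hT hxw hadj.symm hr' hrB
        simp at h2

theorem branch_eq_insert_biUnion (hT : T.IsTree) (hxw : T.Adj x w) :
    branch T x w = {w} ∪ ⋃ a ∈ {a | T.Adj w a ∧ a ≠ x}, branch T w a := by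
  apply Set.Subset.antisymm
  · intro y hy
    by_cases hyw : y = w
    · exact Or.inl hyw
    · obtain ⟨a, ha, hya⟩ := exists_mem_branch hT hyw
      refine Or.inr (Set.mem_biUnion ⟨ha, ?_⟩ hya)
      rintro rfl
      exact (notMem_branch hT hxw.symm).2 hy hya
  · rintro y (rfl | hy)
    · exact right_mem_branch hxw
    · simp only [Set.mem_iUnion, Set.mem_ofPred_eq] at hy
      obtain ⟨a, ⟨ha, hax⟩, hya⟩ := hy
      exact branch_subset hT hxw ha hax hya

/-- The cop, all guarded vertices being within distance `d` of him, clears a branch of depth at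
most `2 * ρ + 1 - d`; here `k = ρ - d`. He traverses the branch down to depth `ρ + 1 - d` by
depth-first search, never losing control of the guarded vertices. -/
theorem sweep_branch [Fintype V] (hT : T.IsTree) (k : ℕ) :
    ∀ (d : ℕ) (x w : V) (S : Set V), d + k = ρ → T.Adj x w →
      (∀ y ∈ branch T x w, T.dist x y ≤ ρ + 1 + k) → x ∈ S → Guards T x d S →
      Sweep T ρ (x, S) (x, S ∪ branch T x w) := by
  classical
  induction k with
  | zero =>
    rintro d x w S rfl hxw hdepth - hS
    exact sweep_branch_of_depth_le hT hxw hdepth hS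
  | succ k ih =>
    intro d x w S hd hxw hdepth hx hS
    have hSw := hS.union_singleton hT hxw
    have hguard : Guards T w ρ S := by
      intro a ha b hb hab
      have h1 := hS a ha b hb hab
      have h2 := hT.connected.dist_triangle (u := w) (v := x) (w := a)
      rw [SimpleGraph.dist_eq_one_iff_adj.2 hxw.symm] at h2
      omega
    set F : Finset V := Finset.univ.filter fun a => T.Adj w a ∧ a ≠ x with hF
    have hFmem : ∀ a, a ∈ F ↔ T.Adj w a ∧ a ≠ x := fun a => by simp [hF]
    have h1 := sweep_biUnion (ρ := ρ) hT F (fun a ha => ((hFmem a).1 ha).1)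
      (fun a ha S' hx' hS' => by
        obtain ⟨hwa, hax⟩ := (hFmem a).1 ha
        refine ih (d + 1) w a S' (by omega) hwa (fun y hy => ?_) hx' hS'
        have hy' := branch_subset hT hxw hwa hax hy
        have h3 := hdepth y hy'
        rw [mem_branch] at hy'
        omega) (S ∪ {w}) (Or.inr rfl) hSw
    have hunion : S ∪ {w} ∪ ⋃ a ∈ F, branch T w a = S ∪ branch T x w := by
      rw [branch_eq_insert_biUnion hT hxw, Set.union_assoc]
      simp only [hFmem, Set.mem_ofPred_eq]
    rw [hunion] at h1
    have h3 := ((hS.union_branch hT hx hxw).mono (by omega : d ≤ ρ)).sweepStep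
      (Or.inr hxw.symm)
    have hxmem : x ∈ S ∪ branch T x w := Or.inl hx
    rw [Set.union_eq_left.2 (Set.singleton_subset_iff.2 hxmem)] at h3
    exact ((Relation.ReflTransGen.single (hguard.sweepStep (Or.inr hxw))).trans h1.1).tail h3

end Sweep

/-! ### The patrol -/

section Patrol

variable {V : Type*} {T : SimpleGraph V} {ρ : ℕ}

/-- In a tree, of two branches at `x` that do not contain an end `o` of a longest path, one is no
deeper than the distance from `o` to `x`. -/
theorem exists_dist_le_of_forall_dist_le (hT : T.IsTree) {o z x : V}
    (hoz : ∀ a b, T.dist a b ≤ T.dist o z) {w y : Fin 2 → V} (hw : Function.Injective w)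
    (hadj : ∀ i, T.Adj x (w i)) (hy : ∀ i, y i ∈ branch T x (w i)) : ∃ i, T.dist x (y i) ≤ T.dist o x := by
  have : ∃ i, z ∉ branch T x (w i) := by
    by_contra! h
    exact absurd (hw (branch_unique hT (hadj 0) (hadj 1) (h 0) (h 1))) (by decide)
  obtain ⟨i, hi⟩ := this
  refine ⟨i, ?_⟩
  have h1 := dist_of_mem_branch hT (hadj i) (hy i) hi
  have h2 := hoz (y i) z
  have h3 := hT.connected.dist_triangle (u := o) (v := x) (w := z)
  omega

/-- Walking away from an end `o` of a longest path, the cop clears all branches of small depth and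
then enters the remaining branch, of which there is at most one. When he arrives at `x`, exactly
the vertices strictly below `x` in the tree rooted at `o` remain to be cleared. -/
theorem sweep_from [Fintype V] (hT : T.IsTree)
    (hno : ∀ v, ¬ HasLongBranches T v (2 * ρ + 2)) {o z : V} (hoz : ∀ a b, T.dist a b ≤ T.dist o z)
    (n : ℕ) : ∀ x, (∀ y, T.dist o y ≤ T.dist o x + n) →
    ∃ c, Sweep T ρ (x, {y | y = x ∨ T.dist o y ≠ T.dist o x + T.dist x y}) (c, Set.univ) := by
  classical
  induction n with
  | zero =>
    intro x hx
    refine ⟨x, ?_⟩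
    have : {y | y = x ∨ T.dist o y ≠ T.dist o x + T.dist x y} = Set.univ := by
      refine Set.eq_univ_of_forall fun y => or_iff_not_imp_left.2 fun hne => ?_
      have := hT.connected.pos_dist_of_ne (Ne.symm hne)
      have := hx y
      omega
    rw [this]
  | succ n ih =>
    intro x hx
    set S := {y | y = x ∨ T.dist o y ≠ T.dist o x + T.dist x y} with hS
    have hxS : x ∈ S := Or.inl rfl
    have hbr : ∀ y ∉ S, ∃ w, T.Adj x w ∧ o ∉ branch T x w ∧ y ∈ branch T x w := by
      intro y hy
      simp only [hS, Set.mem_ofPred_eq, not_or, not_not] at hy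
      obtain ⟨w, hw, hyw⟩ := exists_mem_branch hT hy.1
      refine ⟨w, hw, fun ho => ?_, hyw⟩
      have h1 := hT.connected.dist_triangle (u := o) (v := w) (w := y)
      rw [mem_branch] at hyw ho
      rw [SimpleGraph.dist_comm (u := x), SimpleGraph.dist_comm (u := w)] at ho
      omega
    have hSbr : ∀ w, T.Adj x w → o ∉ branch T x w → ∀ a ∈ branch T x w, a ∉ S := by
      rintro w hw ho a ha (rfl | h)
      · exact left_notMem_branch ha
      · exact h (dist_eq_add_of_mem_branch hT hw ha ho)
    have hguard : Guards T x 0 S := by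
      intro a ha b hb hab
      obtain ⟨w, hw, ho, hbw⟩ := hbr b hb
      obtain ⟨-, rfl⟩ := eq_of_adj_of_mem_branch hT hw hab.symm hbw
        (fun h => hSbr w hw ho a h ha)
      simp
    set F : Finset V := Finset.univ.filter fun w =>
      T.Adj x w ∧ ∀ y ∈ branch T x w, T.dist x y ≤ ρ + 1 + ρ with hF
    have hFmem : ∀ w, w ∈ F ↔ T.Adj x w ∧ ∀ y ∈ branch T x w, T.dist x y ≤ ρ + 1 + ρ :=
      fun w => by simp [hF]
    obtain ⟨hsw, -⟩ := sweep_biUnion (ρ := ρ) (d := 0) hT F (fun w hw => ((hFmem w).1 hw).1)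
      (fun w hw S' hx' hS' => sweep_branch hT ρ 0 x w S' (by omega) ((hFmem w).1 hw).1
        ((hFmem w).1 hw).2 hx' hS') S hxS hguard
    by_cases hlong : ∃ w, T.Adj x w ∧ o ∉ branch T x w ∧ w ∉ F
    · obtain ⟨w, hw, ho, hwF⟩ := hlong
      obtain ⟨y, hy, hyd⟩ : ∃ y ∈ branch T x w, 2 * ρ + 2 ≤ T.dist x y := by
        by_contra! h
        exact hwF ((hFmem w).2 ⟨hw, fun y hy => by have := h y hy; omega⟩)
      have howd : T.dist o w = T.dist o x + 1 := by
        rw [dist_eq_add_of_mem_branch hT hw (right_mem_branch hw) ho,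
          SimpleGraph.dist_eq_one_iff_adj.2 hw]
      have honly : ∀ w', T.Adj x w' → o ∉ branch T x w' → w' ∉ F → w' = w := by
        intro w' hw' ho' hw'F
        by_contra hne
        obtain ⟨y', hy', hyd'⟩ : ∃ y ∈ branch T x w', 2 * ρ + 2 ≤ T.dist x y := by
          by_contra! h
          exact hw'F ((hFmem w').2 ⟨hw', fun y hy => by have := h y hy; omega⟩)
        have hox : 2 * ρ + 2 ≤ T.dist x o := by
          obtain ⟨i, hi⟩ := exists_dist_le_of_forall_dist_le hT hoz (x := x) (w := ![w', w])
            (y := ![y', y]) (by intro i j; fin_cases i <;> fin_cases j <;> simp [hne, Ne.symm hne])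
            (by intro i; fin_cases i <;> simp [hw, hw'])
            (by intro i; fin_cases i <;> simp [hy, hy'])
          rw [SimpleGraph.dist_comm]
          fin_cases i <;> simp at hi <;> omega
        obtain ⟨u, hu, hou⟩ := exists_mem_branch hT (x := x) (y := o) (by
          rintro rfl
          simp at hox)
        have huw : u ≠ w := fun h => ho (h ▸ hou)
        have huw' : u ≠ w' := fun h => ho' (h ▸ hou)
        refine hno x ⟨![u, w, w'], ![o, y, y'], ?_, ?_⟩
        · intro i j
          fin_cases i <;> fin_cases j <;> simp [hne, Ne.symm hne, huw, huw', huw.symm, huw'.symm]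
        · intro i
          fin_cases i <;> simp [hu, hw, hw', hou, hy, hy', hox, hyd, hyd']
      obtain ⟨c, hc⟩ := ih w (fun y => by have := hx y; omega)
      refine ⟨c, (hsw.tail (c := (w, _)) ⟨Or.inr hw, ?_⟩).trans hc⟩
      -- A robber not captured so far is in the branch behind `w`, and the cop meets him there if
      -- he is about to leave it.
      intro r hr r' hrr' _ h2 h3 hr'
      dsimp only at hr h2 h3 hr'
      have hrB : r ∈ branch T x w := by
        obtain ⟨w', hw', ho', hrw'⟩ := hbr r fun h => hr (Or.inl h)
        have hw'F : w' ∉ F := fun h => hr (Or.inr (Set.mem_biUnion h hrw'))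
        rwa [← honly w' hw' ho' hw'F]
      have hr'B : r' ∈ branch T x w := by
        rcases hrr' with rfl | hadj
        · exact hrB
        · by_contra hr'B
          obtain ⟨rfl, -⟩ := eq_of_adj_of_mem_branch hT hw hadj hrB hr'B
          simp at h2
      rcases hr' with rfl | hr'
      · simp at h3
      · have := dist_eq_add_of_mem_branch hT hw hr'B ho
        rw [mem_branch] at hr'B
        omega
    · push Not at hlong
      refine ⟨x, ?_⟩
      convert hsw
      refine (Set.eq_univ_of_forall fun y => ?_).symm
      by_contra hy
      obtain ⟨w, hw, ho, hyw⟩ := hbr y fun h => hy (Or.inl h)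
      exact hy (Or.inr (Set.mem_biUnion (hlong w hw ho) hyw))

theorem copWins_of_forall_not_hasLongBranches [Fintype V] (hT : T.IsTree)
    (hno : ∀ v, ¬ HasLongBranches T v (2 * ρ + 2)) : CopWins T ρ := by
  have := hT.connected.nonempty
  obtain ⟨⟨o, z⟩, hoz⟩ := Finite.exists_max fun p : V × V => T.dist p.1 p.2
  obtain ⟨c, hc⟩ := sweep_from hT hno (z := z) (fun a b => hoz (a, b)) (T.dist o z) o
    (fun y => (hoz (o, y)).trans (Nat.le_add_left _ _))
  refine copWins_of_sweep (x := o) (c := c) (Relation.ReflTransGen.head ?_ hc)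
  refine ⟨Or.inl rfl, ?_⟩
  rintro r - r' - - - h3 (rfl | h)
  · simp at h3
  · simp at h

end Patrol

/-! ### Evading a patrol -/

section Evade

variable {V : Type*} {T : SimpleGraph V} {v w : V} {L : ℕ}

/-- A branch of depth at least `L` at `v` contains a geodesic of length `L` that starts from `v`. -/
theorem exists_leg (hT : T.IsTree) (hw : T.Adj v w) {a : V} (ha : a ∈ branch T v w)
    (hL : L ≤ T.dist v a) : ∃ g : ℕ → V, g 0 = v ∧ (∀ m < L, T.Adj (g m) (g (m + 1))) ∧
      (∀ m ≤ L, T.dist v (g m) = m) ∧ ∀ m, 1 ≤ m → m ≤ L → g m ∈ branch T v w := by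
  obtain ⟨p, hp⟩ := hT.connected.exists_walk_length_eq_dist v a
  have key : ∀ m ≤ L, T.dist v (p.getVert m) = m ∧
      T.dist (p.getVert m) a + m = T.dist v a := by
    intro m hm
    have h1 := SimpleGraph.dist_le (p.take m)
    have h2 := SimpleGraph.dist_le (p.drop m)
    have h3 := hT.connected.dist_triangle (u := v) (v := p.getVert m) (w := a)
    rw [SimpleGraph.Walk.take_length] at h1
    rw [SimpleGraph.Walk.drop_length] at h2
    omega
  refine ⟨p.getVert, p.getVert_zero, fun m hm => p.adj_getVert_succ (by omega),
    fun m hm => (key m hm).1, fun m h1 hm => ?_⟩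
  by_contra hmem
  have h2 := dist_of_mem_branch hT hw ha hmem
  have h3 := (key m hm).2
  rw [SimpleGraph.dist_comm] at h2
  omega

open Classical in
/-- The depth of `c` in the branch at `v` behind `w`; a vertex outside the branch has as depth its
distance from `v` with the negative sign. -/
noncomputable def signedDepth (T : SimpleGraph V) (v w c : V) : ℤ :=
  if c ∈ branch T v w then T.dist v c else -T.dist v c

theorem signedDepth_of_mem {c : V} (hc : c ∈ branch T v w) : signedDepth T v w c = T.dist v c :=
  if_pos hc

theorem signedDepth_of_notMem {c : V} (hc : c ∉ branch T v w) :
    signedDepth T v w c = -T.dist v c :=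
  if_neg hc

theorem signedDepth_of_adj (hT : T.IsTree) (hw : T.Adj v w) {a b : V} (hab : T.Adj a b) :
    signedDepth T v w a ≤ signedDepth T v w b + 1 ∧
      signedDepth T v w b ≤ signedDepth T v w a + 1 := by
  have h1 := hT.dist_eq_dist_add_one_of_adj v hab
  have h2 := SimpleGraph.dist_eq_one_iff_adj.2 hw
  by_cases ha : a ∈ branch T v w <;> by_cases hb : b ∈ branch T v w
  · rw [signedDepth_of_mem ha, signedDepth_of_mem hb]
    omega
  · obtain ⟨rfl, rfl⟩ := eq_of_adj_of_mem_branch hT hw hab ha hb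
    rw [signedDepth_of_mem ha, signedDepth_of_notMem hb, SimpleGraph.dist_self]
    omega
  · obtain ⟨rfl, rfl⟩ := eq_of_adj_of_mem_branch hT hw hab.symm hb ha
    rw [signedDepth_of_mem hb, signedDepth_of_notMem ha, SimpleGraph.dist_self]
    omega
  · rw [signedDepth_of_notMem ha, signedDepth_of_notMem hb]
    omega

theorem sub_signedDepth_le_dist (hT : T.IsTree) (hw : T.Adj v w) {c x : V}
    (hx : x = v ∨ x ∈ branch T v w) : (T.dist v x : ℤ) - signedDepth T v w c ≤ T.dist c x := by
  have htri := hT.connected.dist_triangle (u := v) (v := c) (w := x)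
  by_cases hc : c ∈ branch T v w
  · rw [signedDepth_of_mem hc]
    omega
  · rw [signedDepth_of_notMem hc]
    rcases hx with rfl | hx
    · rw [SimpleGraph.dist_self, SimpleGraph.dist_comm (u := c)]
      simp
    · rw [SimpleGraph.dist_comm (u := c), dist_of_mem_branch hT hw hx hc]
      omega

/-- At most one of three objects is forbidden at each time. Then there is a choice that avoids the
objects forbidden now and at the next time, and changes only at times when one is forbidden: keep
away from the last and from the next object that is forbidden. -/
theorem exists_avoiding (δ : ℕ → Option (Fin 3)) : ∃ k : ℕ → Fin 3, ∀ t,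
    δ t ≠ some (k t) ∧ δ (t + 1) ≠ some (k t) ∧ (δ (t + 1) = none → k (t + 1) = k t) := by
  let last : ℕ → Option (Fin 3) := fun t => Nat.rec (δ 0) (fun t l => (δ (t + 1)).or l) t
  have hlast : ∀ t, δ t ≠ none → last t = δ t := by
    rintro (_ | t) h
    · rfl
    · exact Option.or_of_isSome (Option.isSome_iff_ne_none.2 h)
  have hlast' : ∀ t, δ (t + 1) = none → last (t + 1) = last t := by
    intro t h
    change (δ (t + 1)).or (last t) = last t
    rw [h, Option.none_or]
  -- If nothing is forbidden from time `t + 1` on, `next t` has the junk value `δ 0`, which is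
  -- harmless.
  let next : ℕ → Option (Fin 3) := fun t => δ (sInf {n | t + 1 ≤ n ∧ δ n ≠ none})
  have hnext : ∀ t, δ (t + 1) ≠ none → next t = δ (t + 1) := by
    intro t h
    have : IsLeast {n | t + 1 ≤ n ∧ δ n ≠ none} (t + 1) := ⟨⟨le_rfl, h⟩, fun n hn => hn.1⟩
    exact congrArg δ this.csInf_eq
  have hnext' : ∀ t, δ (t + 1) = none → next (t + 1) = next t := by
    intro t h
    have : {n | t + 1 + 1 ≤ n ∧ δ n ≠ none} = {n | t + 1 ≤ n ∧ δ n ≠ none} := by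
      ext n
      refine ⟨fun hn => ⟨by have := hn.1; omega, hn.2⟩, fun hn => ⟨?_, hn.2⟩⟩
      have hne : n ≠ t + 1 := fun e => hn.2 (e ▸ h)
      have := hn.1
      omega
    change δ _ = δ _
    rw [this]
  have hex : ∀ a b : Option (Fin 3), ∃ k, a ≠ some k ∧ b ≠ some k := by decide
  choose f hf using hex
  refine ⟨fun t => f (last t) (next t), fun t => ⟨fun h => ?_, fun h => ?_, fun h => ?_⟩⟩
  · exact (hf (last t) (next t)).1 ((hlast t (by simp [h])).trans h)
  · exact (hf (last t) (next t)).2 ((hnext t (by simp [h])).trans h)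
  · simp only [hlast' t h, hnext' t h]

/-- If three branches at `v` have depth at least `2 * ρ + 2`, the robber evades every patrol. He
stays in a branch that the cop does not enter deeper than `ρ + 1` before the next deep visit of
the cop to another branch, at distance more than `ρ` beyond the cop, and he changes the branch
at `v` while the cop is at depth at least `ρ + 2` in some branch. -/
theorem not_copWins_of_hasLongBranches {ρ : ℕ} (hT : T.IsTree)
    (h : HasLongBranches T v (2 * ρ + 2)) : ¬ CopWins T ρ := by
  classical
  rintro ⟨c, hc, hcap⟩
  obtain ⟨w, a, hinj, hwa⟩ := h
  choose hw ha hL using hwa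
  choose g hg0 hgadj hgdist hgmem using fun i => exists_leg hT (hw i) (ha i) (hL i)
  let s : Fin 3 → ℕ → ℤ := fun i t => signedDepth T v (w i) (c t)
  have hs : ∀ i t, s i t ≤ s i (t + 1) + 1 ∧ s i (t + 1) ≤ s i t + 1 := by
    intro i t
    rcases hc t with h | h
    · simp only [s, h]
      omega
    · exact signedDepth_of_adj hT (hw i) h
  have hdeep : ∀ i j t, (ρ : ℤ) + 2 ≤ s i t → j ≠ i → s j t ≤ -((ρ : ℤ) + 2) := by
    intro i j t hi hji
    have hmem : c t ∈ branch T v (w i) := by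
      by_contra hmem
      simp only [s, signedDepth_of_notMem hmem] at hi
      omega
    have hmem' : c t ∉ branch T v (w j) := fun hj =>
      hji (hinj (branch_unique hT (hw j) (hw i) hj hmem))
    simp only [s, signedDepth_of_mem hmem] at hi
    simp only [s, signedDepth_of_notMem hmem']
    omega
  obtain ⟨k, hk⟩ := exists_avoiding fun t =>
    if h : ∃ i, (ρ : ℤ) + 2 ≤ s i t then some h.choose else none
  have hδ : ∀ t i, (ρ : ℤ) + 2 ≤ s i t →
      (if h : ∃ i, (ρ : ℤ) + 2 ≤ s i t then some h.choose else none) = some i := by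
    intro t i hi
    have hex : ∃ i, (ρ : ℤ) + 2 ≤ s i t := ⟨i, hi⟩
    rw [dif_pos hex]
    by_contra hne
    have := hdeep i hex.choose t hi (fun e => hne (by rw [e]))
    have := hex.choose_spec
    omega
  have hk1 : ∀ t, s (k t) t ≤ ρ + 1 := by
    intro t
    by_contra! hlt
    exact (hk t).1 (hδ t (k t) (by omega))
  have hk2 : ∀ t, s (k t) (t + 1) ≤ ρ + 1 := by
    intro t
    by_contra! hlt
    exact (hk t).2.1 (hδ (t + 1) (k t) (by omega))
  let m : ℕ → ℕ := fun t => (ρ + 1 + max (s (k t) t) (s (k t) (t + 1))).toNat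
  have hm : ∀ t, m t ≤ 2 * ρ + 2 := by
    intro t
    have := hk1 t
    have := hk2 t
    simp only [m]
    omega
  have hesc : ∀ t c', signedDepth T v (w (k t)) c' ≤ max (s (k t) t) (s (k t) (t + 1)) →
      ρ < T.dist c' (g (k t) (m t)) := by
    intro t c' hc'
    have hpos : g (k t) (m t) = v ∨ g (k t) (m t) ∈ branch T v (w (k t)) := by
      rcases Nat.eq_zero_or_pos (m t) with h0 | h0
      · rw [h0]
        exact Or.inl (hg0 _)
      · exact Or.inr (hgmem _ _ h0 (hm t))
    have h1 := sub_signedDepth_le_dist hT (hw (k t)) (c := c') hpos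
    rw [hgdist _ _ (hm t)] at h1
    simp only [m] at *
    omega
  obtain ⟨t, ht⟩ := hcap (fun t => g (k t) (m t)) (by
    intro t
    by_cases hkt : k (t + 1) = k t
    · have h1 := hs (k t) t
      have h2 := hs (k t) (t + 1)
      have h3 := hm t
      have h4 := hm (t + 1)
      have hcases : m (t + 1) = m t ∨ m (t + 1) = m t + 1 ∨ m t = m (t + 1) + 1 := by
        simp only [m, hkt]
        omega
      simp only [hkt]
      rcases hcases with h | h | h
      · exact Or.inl (by rw [h])
      · rw [h]
        exact Or.inr (hgadj _ _ (by omega))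
      · rw [h]
        exact Or.inr (hgadj _ _ (by omega)).symm
    · left
      obtain ⟨j, hj⟩ : ∃ j, (ρ : ℤ) + 2 ≤ s j (t + 1) := by
        by_contra hno
        exact hkt ((hk t).2.2 (dif_neg hno))
      have hjt : k t ≠ j := fun e => by have := hk2 t; rw [e] at this; omega
      have hjt' : k (t + 1) ≠ j := fun e => by have := hk1 (t + 1); rw [e] at this; omega
      have h1 := hdeep j _ _ hj hjt
      have h2 := hdeep j _ _ hj hjt'
      have h3 := hs (k t) t
      have h4 := hs (k (t + 1)) (t + 1)
      have hm0 : m t = 0 := by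
        simp only [m]
        omega
      have hm1 : m (t + 1) = 0 := by
        simp only [m]
        omega
      dsimp only
      rw [hm0, hm1, hg0, hg0])
  have h1 := hesc t (c t) (le_max_left _ _)
  have h2 := hesc t (c (t + 1)) (le_max_right _ _)
  dsimp only at ht
  omega

end Evade

/-! ### Triods and long branches -/

section Triod

variable {V : Type*} {T : SimpleGraph V} {v : V} {L : ℕ}

theorem exists_mem_leaves_mem_branch [Finite V] (hT : T.IsTree) {u w : V} (h : T.Adj u w) :
    ∃ a ∈ branch T u w, a ∈ leaves T := by
  obtain ⟨a, ha, hmax⟩ := Set.exists_max_image (branch T u w) (T.dist u) (Set.toFinite _)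
    ⟨w, right_mem_branch h⟩
  refine ⟨a, ha, Set.ncard_eq_one.2 ?_⟩
  have hau : u ≠ a := by
    rintro rfl
    exact left_notMem_branch ha
  obtain ⟨b, hb, hub⟩ := exists_mem_branch hT hau
  refine ⟨b, Set.Subset.antisymm (fun c hc => ?_) (Set.singleton_subset_iff.2 hb)⟩
  -- A neighbour of `a` on the side away from `u` would be a deeper vertex of the branch.
  by_contra hne
  have huc : u ∉ branch T a c := fun huc => hne (branch_unique hT hc hb huc hub)
  rw [notMem_branch hT hc, SimpleGraph.dist_comm, SimpleGraph.dist_comm (u := a)] at huc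
  have hcB : c ∈ branch T u w := by
    by_contra hcB
    obtain ⟨-, rfl⟩ := eq_of_adj_of_mem_branch hT h hc ha hcB
    simp at huc
  have := hmax c hcB
  omega

theorem dist_induce (hT : T.IsTree) {s : Set V} (hs : (T.induce s).Connected) (x y : s) :
    (T.induce s).dist x y = T.dist x y := by
  obtain ⟨p, hp, hpl⟩ := hs.exists_path_of_dist x y
  obtain ⟨q, hq, hql⟩ := hT.connected.exists_path_of_dist (x : V) y
  have hp' := hp.map (f := (SimpleGraph.Embedding.induce s).toHom) Subtype.val_injective
  have h := congrArg (fun r => r.1.length)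
    ((hT.isAcyclic.subsingleton_path _ _).elim ⟨_, hp'⟩ ⟨q, hq⟩)
  rw [← hpl, ← hql]
  exact (SimpleGraph.Walk.length_map _ p).symm.trans h

theorem hasLongBranches_of_isTriod [Finite V] (hT : T.IsTree) {s : Set V} {hv : v ∈ s}
    (h : IsTriod (T.induce s) ⟨v, hv⟩) (hL : L ≤ triodSize (T.induce s) ⟨v, hv⟩) :
    HasLongBranches T v L := by
  obtain ⟨hH, -, h3⟩ := h
  obtain ⟨x, y, z, hxy, hxz, hyz, hN⟩ := Set.ncard_eq_three.1 ((h3 _).2 rfl)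
  have hadj : ∀ i, (T.induce s).Adj ⟨v, hv⟩ (![x, y, z] i) := by
    intro i
    rw [← SimpleGraph.mem_neighborSet, hN]
    fin_cases i <;> simp
  choose a ha hleaf using fun i => exists_mem_leaves_mem_branch hH (hadj i)
  refine ⟨fun i => ![x, y, z] i, fun i => a i, ?_, fun i => ⟨hadj i, ?_, ?_⟩⟩
  · refine Subtype.val_injective.comp fun i j => ?_
    fin_cases i <;> fin_cases j <;> simp [hxy, hxz, hyz, hxy.symm, hxz.symm, hyz.symm]
  · have := ha i
    rwa [mem_branch, dist_induce hT hH.connected, dist_induce hT hH.connected] at this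
  · refine hL.trans ?_
    rw [← dist_induce hT hH.connected ⟨v, hv⟩ (a i)]
    exact Nat.sInf_le ⟨a i, hleaf i, rfl⟩

theorem ncard_neighborSet_induce (G : SimpleGraph V) (s : Set V) (x : s) :
    ((G.induce s).neighborSet x).ncard = {y ∈ s | G.Adj x y}.ncard := by
  rw [← Set.ncard_image_of_injective _ Subtype.val_injective]
  congr 1
  ext y
  simp [and_comm]

/-- Geodesics of length `L` in three branches at `v` form an induced triod of size `L`. -/
theorem le_ell3_of_hasLongBranches [Finite V] (hT : T.IsTree) (hL : 1 ≤ L)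
    (h : HasLongBranches T v L) : L ≤ ell3 T v := by
  obtain ⟨w, a, hinj, hwa⟩ := h
  choose hw ha hLa using hwa
  choose g hg0 hgadj hgdist hgmem using fun i => exists_leg hT (hw i) (ha i) (hLa i)
  have hleg : ∀ i j m n, 1 ≤ m → m ≤ L → n ≤ L → g j n ∈ branch T v (w i) → j = i := by
    intro i j m n hm hmL hnL hmem
    rcases Nat.eq_zero_or_pos n with rfl | hn
    · rw [hg0] at hmem
      exact absurd hmem left_notMem_branch
    · exact hinj (branch_unique hT (hw j) (hw i) (hgmem j n hn hnL) hmem)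
  have hginj : ∀ i j m n, 1 ≤ m → m ≤ L → n ≤ L → g i m = g j n → i = j ∧ m = n := by
    intro i j m n hm hmL hnL he
    refine ⟨(hleg i j m n hm hmL hnL (he ▸ hgmem i m hm hmL)).symm, ?_⟩
    rw [← hgdist i m hmL, he, hgdist j n hnL]
  set s : Set V := {x | ∃ i, ∃ m ≤ L, x = g i m} with hs
  have hmem : ∀ i, ∀ m ≤ L, g i m ∈ s := fun i m hm => ⟨i, m, hm, rfl⟩
  have hv : v ∈ s := ⟨0, 0, L.zero_le, (hg0 0).symm⟩
  have hnbr : ∀ i m, 1 ≤ m → m ≤ L → ∀ y ∈ s, T.Adj (g i m) y →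
      y = g i (m - 1) ∨ m < L ∧ y = g i (m + 1) := by
    rintro i m hm hmL y ⟨j, n, hn, rfl⟩ hadj
    have hd := hT.dist_eq_dist_add_one_of_adj v hadj
    rw [hgdist i m hmL, hgdist j n hn] at hd
    by_cases hB : g j n ∈ branch T v (w i)
    · obtain rfl := hleg i j m n hm hmL hn hB
      rcases hd with rfl | rfl
      · exact Or.inl rfl
      · exact Or.inr ⟨hn, rfl⟩
    · have h1 := (eq_of_adj_of_mem_branch hT (hw i) hadj (hgmem i m hm hmL) hB).2
      have h2 := hgdist j n hn
      rw [h1, SimpleGraph.dist_self] at h2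
      obtain rfl : m = 1 := by omega
      exact Or.inl (by rw [h1, Nat.sub_self, hg0])
  have hadjpred : ∀ i m, 1 ≤ m → m ≤ L → T.Adj (g i m) (g i (m - 1)) := by
    intro i m hm hmL
    have := hgadj i (m - 1) (by omega)
    rw [Nat.sub_add_cancel hm] at this
    exact this.symm
  have hcard_tip : ∀ i, {y ∈ s | T.Adj (g i L) y}.ncard = 1 := by
    intro i
    refine Set.ncard_eq_one.2 ⟨g i (L - 1), Set.Subset.antisymm ?_ ?_⟩
    · rintro y ⟨hy, hadj⟩
      rcases hnbr i L hL le_rfl y hy hadj with h | ⟨h, -⟩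
      · exact h
      · omega
    · rintro y rfl
      exact ⟨hmem i _ (by omega), hadjpred i L hL le_rfl⟩
  have hcard_mid : ∀ i m, 1 ≤ m → m < L → {y ∈ s | T.Adj (g i m) y}.ncard = 2 := by
    intro i m hm hmL
    refine Set.ncard_eq_two.2 ⟨g i (m + 1), g i (m - 1), fun he => ?_,
      Set.Subset.antisymm ?_ ?_⟩
    · have := (hginj i i (m + 1) (m - 1) (by omega) hmL (by omega) he).2
      omega
    · rintro y ⟨hy, hadj⟩
      rcases hnbr i m hm hmL.le y hy hadj with h | ⟨-, h⟩
      · exact Or.inr h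
      · exact Or.inl h
    · rintro y (rfl | rfl)
      · exact ⟨hmem i _ hmL, hgadj i m hmL⟩
      · exact ⟨hmem i _ (by omega), hadjpred i m hm hmL.le⟩
  have hcard_fin : ∀ f : Fin 3 → V, Function.Injective f → (Set.range f).ncard = 3 := by
    intro f hf
    rw [← Set.image_univ, Set.ncard_image_of_injective _ hf, Set.ncard_univ, Nat.card_fin]
  have hcard_origin : {y ∈ s | T.Adj v y}.ncard = 3 := by
    rw [← hcard_fin (fun i => g i 1) fun i j he => (hginj i j 1 1 le_rfl hL hL he).1]
    congr 1
    refine Set.Subset.antisymm ?_ ?_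
    · rintro y ⟨⟨j, n, hn, rfl⟩, hadj⟩
      have h1 := SimpleGraph.dist_eq_one_iff_adj.2 hadj
      rw [hgdist j n hn] at h1
      exact ⟨j, by rw [h1]⟩
    · rintro y ⟨i, rfl⟩
      refine ⟨hmem i 1 hL, ?_⟩
      have := hgadj i 0 hL
      rwa [hg0] at this
  have hcases : ∀ x ∈ s, x = v ∨ (∃ i, x = g i L) ∨ ∃ i m, 1 ≤ m ∧ m < L ∧ x = g i m := by
    rintro x ⟨i, m, hm, rfl⟩
    rcases Nat.eq_zero_or_pos m with rfl | hm0
    · exact Or.inl (hg0 i)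
    · rcases hm.eq_or_lt with rfl | hmL
      · exact Or.inr (Or.inl ⟨i, rfl⟩)
      · exact Or.inr (Or.inr ⟨i, m, hm0, hmL, rfl⟩)
  have hconn : (T.induce s).Connected := by
    refine SimpleGraph.connected_iff_exists_forall_reachable _ |>.2 ⟨⟨v, hv⟩, ?_⟩
    have key : ∀ i m (hm : m ≤ L), (T.induce s).Reachable ⟨v, hv⟩ ⟨g i m, hmem i m hm⟩ := by
      intro i m
      induction m with
      | zero =>
        intro hm
        have : (⟨v, hv⟩ : s) = ⟨g i 0, hmem i 0 hm⟩ := Subtype.ext (hg0 i).symm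
        rw [this]
      | succ m ih =>
        intro hm
        refine (ih (by omega)).trans (SimpleGraph.Adj.reachable ?_)
        exact hgadj i m hm
    rintro ⟨x, i, m, hm, rfl⟩
    exact key i m hm
  have hleaves : ∀ x : s, x ∈ leaves (T.induce s) ↔ ∃ i, (x : V) = g i L := by
    rintro ⟨x, hx⟩
    change ((T.induce s).neighborSet ⟨x, hx⟩).ncard = 1 ↔ _
    rw [ncard_neighborSet_induce]
    refine ⟨fun h1 => ?_, ?_⟩
    · rcases hcases x hx with rfl | h | ⟨i, m, hm, hmL, rfl⟩
      · rw [hcard_origin] at h1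
        omega
      · exact h
      · rw [hcard_mid i m hm hmL] at h1
        omega
    · rintro ⟨i, rfl⟩
      exact hcard_tip i
  have hleaves3 : (leaves (T.induce s)).ncard = 3 := by
    rw [← hcard_fin (fun i => g i L) fun i j he => (hginj i j L L hL le_rfl le_rfl he).1,
      ← Set.ncard_image_of_injective _ Subtype.val_injective]
    congr 1
    ext x
    constructor
    · rintro ⟨y, hy, rfl⟩
      obtain ⟨i, hi⟩ := (hleaves y).1 hy
      exact ⟨i, hi.symm⟩
    · rintro ⟨i, rfl⟩
      exact ⟨⟨_, hmem i L le_rfl⟩, (hleaves _).2 ⟨i, rfl⟩, rfl⟩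
  have htriod : IsTriod (T.induce s) ⟨v, hv⟩ := by
    refine ⟨⟨hconn, hT.isAcyclic.induce s⟩, hleaves3, ?_⟩
    rintro ⟨x, hx⟩
    rw [ncard_neighborSet_induce]
    refine ⟨fun h3 => Subtype.ext ?_, fun h => ?_⟩
    · rcases hcases x hx with h | ⟨i, rfl⟩ | ⟨i, m, hm, hmL, rfl⟩
      · exact h
      · rw [hcard_tip i] at h3
        omega
      · rw [hcard_mid i m hm hmL] at h3
        omega
    · obtain rfl : x = v := congrArg Subtype.val h
      exact hcard_origin
  refine le_trans ?_ (le_csSup (bddAbove_inducedTriodSizes T v) ⟨s, hv, htriod, rfl⟩)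
  refine le_csInf ((Set.nonempty_of_ncard_ne_zero (by omega)).image _) ?_
  rintro _ ⟨x, hx, rfl⟩
  obtain ⟨i, hi⟩ := (hleaves x).1 hx
  rw [dist_induce hT hconn, hi, hgdist i L le_rfl]

theorem hasLongBranches_iff_le_ell3 [Finite V] (hT : T.IsTree) (hL : 1 ≤ L) :
    HasLongBranches T v L ↔ L ≤ ell3 T v := by
  refine ⟨le_ell3_of_hasLongBranches hT hL, fun h => ?_⟩
  have hne : (inducedTriodSizes T v).Nonempty := by
    by_contra hne
    rw [Set.not_nonempty_iff_eq_empty] at hne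
    rw [ell3, hne, csSup_empty, bot_eq_zero] at h
    omega
  obtain ⟨s, hv, htriod, hk⟩ := Nat.sSup_mem hne (bddAbove_inducedTriodSizes T v)
  exact hasLongBranches_of_isTriod hT htriod (hk ▸ h)

end Triod

end PatrolGame

/-! ### The capture radius -/

theorem mainTheorem1 {V : Type*} [Fintype V] (T : SimpleGraph V) (hT : T.IsTree) :
    PatrolGame.captureRadius T =
      Finset.univ.sup (fun v : V => PatrolGame.ell3 T v / 2) := by
  obtain ⟨hwin, hmin⟩ := PatrolGame.isLeast_captureRadius T hT.connected
  refine le_antisymm (hmin ?_) (Finset.sup_le fun v _ => ?_)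
  · refine PatrolGame.copWins_of_forall_not_hasLongBranches hT fun v hv => ?_
    rw [PatrolGame.hasLongBranches_iff_le_ell3 hT (by omega)] at hv
    have := Finset.le_sup (f := fun v : V => PatrolGame.ell3 T v / 2) (Finset.mem_univ v)
    omega
  · by_contra! hlt
    refine PatrolGame.not_copWins_of_hasLongBranches (v := v) hT ?_ hwin
    rw [PatrolGame.hasLongBranches_iff_le_ell3 hT (by omega)]
    omega
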